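/- **Theorem 8.1.** Let $R$ be a commutative ring. A *composition algebra* $(A,q)$ over $R$ is a unital, not necessarily associative $R$-algebra $A$, free of finite rank as an $R$-module, with $R\hookrightarrow A$ via $r\mapsto r\cdot 1$, equipped with a quadratic form $q$ such that $q(xy)=q(x)q(y)$ for all $x,y\in A$ and such that $q$ is non-degenerate: writing $\langle x,y\rangle=q(x+y)-q(x)-q(y)$, if $\langle x,y\rangle=0$ for all $y\in A$, then $x=0$. Its standard involution is $\overline{\alpha}=\langle\alpha,1\rangle 1-\alpha$. A *quaternion algebra* is a composition algebra of rank $4$. Let $(A,q)$ be a quaternion algebra over $R$, let $n\ge 0$, and let $V=A\oplus H(R^n)$ be the quadratic space of triples $(\alpha,v,w)$ with $\alpha\in A$ and $v=(a_1,\dots,a_n)$, $w=(b_1,\dots,b_n)\in R^n$, with the quadratic form $q(\alpha,v,w)=q(\alpha)+a_1b_1+\cdots+a_nb_n$. Put $Z_0=(\alpha)$, $\overline{Z_0}=(\overline{\alpha})$ and, for $1\le i\le n$, define recursively the $2^i\times 2^i$ matrices over $A$ $$Z_i=\begin{pmatrix} a_i & Z_{i-1}\\ -\overline{Z_{i-1}}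 & b_i\end{pmatrix},\qquad \overline{Z_i}=\begin{pmatrix} b_i & -Z_{i-1}\\ \overline{Z_{i-1}} & a_i\end{pmatrix},$$ where $a_i,b_i$ stand for scalar matrices. Write $Z_n(\alpha,v,w)=Z_n$ and $\overline{Z_n(\alpha,v,w)}=\overline{Z_n}$. Then there is a unique homomorphism of (unital) $R$-algebras $\phi:Cl(V)\to M_{2^{n+1}}(A)$ such that $$\phi(\alpha,v,w)=\begin{pmatrix}0&Z_n(\alpha,v,w)\\ \overline{Z_n(\alpha,v,w)}&0\end{pmatrix}\qquad\text{for all }(\alpha,v,w)\in V.$$ It is injective, and it is $\mathbb{Z}_2$-graded: it maps the even part of $Cl(V)$ into the block diagonal matrices $\begin{pmatrix}*&0\\0&*\end{pmatrix}$ and the odd part into the block anti-diagonal matrices $\begin{pmatrix}0&*\\ *&0\end{pmatrix}$ (with blocks of size $2^n\times 2^n$). Moreover, $Cl(V)$ and $M_{2^{n+1}}(A)$ are free $R$-modules of the same finite rank. -/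

import Mathlib

namespace QuatClifford

section Composition

variable {R A : Type*} [CommRing R] [NonAssocRing A] [Module R A]

/-- `(A, q)` is a composition algebra over `R`: a unital, not necessarily associative `R`-algebra,
free of finite rank as an `R`-module, containing `R`, with a non-degenerate quadratic form `q`
such that `q (x y) = q x * q y`. Here `⟨x, y⟩ = q (x + y) - q x - q y` is `QuadraticMap.polar q x y`.
(The bilinearity of the product over `R` is carried by the classes `IsScalarTower R A A`
and `SMulCommClass R A A`.) -/
structure IsCompositionAlgebra [IsScalarTower R A A] [SMulCommClass R A A]
    (q : QuadraticForm R A) : Prop where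
  free : Module.Free R A
  finite : Module.Finite R A
  injective_smul_one : Function.Injective (fun r : R => r • (1 : A))
  nondegenerate : ∀ x : A, (∀ y : A, QuadraticMap.polar q x y = 0) → x = 0
  map_mul : ∀ x y : A, q (x * y) = q x * q y

/-- A quaternion algebra is a composition algebra of rank `4`. -/
structure IsQuaternionAlgebra [IsScalarTower R A A] [SMulCommClass R A A]
    (q : QuadraticForm R A) : Prop extends IsCompositionAlgebra q where
  rank_eq_four : Module.finrank R A = 4

/-- The standard involution of a composition algebra, `conj x = ⟨x, 1⟩ 1 - x`. -/
def conj (q : QuadraticForm R A) (x : A) : A :=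
  QuadraticMap.polar q x 1 • (1 : A) - x

end Composition

section QuadraticSpace

variable {R A : Type*} [CommRing R] [NonAssocRing A] [Module R A]

/-- The hyperbolic space `H(R^n)`, with quadratic form `(v, w) ↦ v ⬝ w`. -/
def hyperbolic (R : Type*) [CommRing R] (n : ℕ) :
    QuadraticForm R ((Fin n → R) × (Fin n → R)) :=
  LinearMap.BilinMap.toQuadraticMap
    ((dotProductBilin R R).compl₁₂
      (LinearMap.fst R (Fin n → R) (Fin n → R)) (LinearMap.snd R (Fin n → R) (Fin n → R)))

theorem hyperbolic_apply (n : ℕ) (v w : Fin n → R) :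
    hyperbolic R n (v, w) = v ⬝ᵥ w := rfl

/-- The quadratic form `(α, v, w) ↦ q α + v ⬝ w` of the quadratic space `A ⊕ H(R^n)`. -/
def spaceForm (q : QuadraticForm R A) (n : ℕ) :
    QuadraticForm R (A × ((Fin n → R) × (Fin n → R))) :=
  QuadraticMap.prod q (hyperbolic R n)

theorem spaceForm_apply (q : QuadraticForm R A) (n : ℕ) (α : A) (v w : Fin n → R) :
    spaceForm q n (α, v, w) = q α + v ⬝ᵥ w := rfl

end QuadraticSpace

section Matrices

variable {R A : Type*}

/-- Splits the `2^(n+1)` indices into the first `2^n` and the last `2^n` of them. -/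
def halves (n : ℕ) : Fin (2 ^ n) ⊕ Fin (2 ^ n) ≃ Fin (2 ^ (n + 1)) :=
  finSumFinEquiv.trans (finCongr (by rw [pow_succ, mul_two]))

/-- The `2^(n+1) × 2^(n+1)` matrix with blocks `X, Y` (first row) and `Z, W` (second row). -/
def block {n : ℕ} (X Y Z W : Matrix (Fin (2 ^ n)) (Fin (2 ^ n)) A) :
    Matrix (Fin (2 ^ (n + 1))) (Fin (2 ^ (n + 1))) A :=
  Matrix.reindex (halves n) (halves n) (Matrix.fromBlocks X Y Z W)

/-- Even elements of `M_{2^(n+1)}(A)`: the block diagonal matrices. -/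
def IsEvenMatrix [Zero A] {n : ℕ}
    (M : Matrix (Fin (2 ^ (n + 1))) (Fin (2 ^ (n + 1))) A) : Prop :=
  ∃ X Y : Matrix (Fin (2 ^ n)) (Fin (2 ^ n)) A, M = block X 0 0 Y

/-- Odd elements of `M_{2^(n+1)}(A)`: the block anti-diagonal matrices. -/
def IsOddMatrix [Zero A] {n : ℕ}
    (M : Matrix (Fin (2 ^ (n + 1))) (Fin (2 ^ (n + 1))) A) : Prop :=
  ∃ X Y : Matrix (Fin (2 ^ n)) (Fin (2 ^ n)) A, M = block 0 X Y 0

variable [CommRing R] [NonAssocRing A] [Module R A]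

/-- The pair `(Z_n(α, v, w), conj Z_n(α, v, w))`, by simultaneous recursion. The recursion is
started with the `1 × 1` matrices `Z_0 = (α)` and `conj Z_0 = (conj α)`, so that
`Z_1 = (a₁, α; -conj α, b₁)` and `conj Z_1 = (b₁, -α; conj α, a₁)`; the last entries of `v` and
`w` are used in the outermost blocks, as scalar matrices. -/
def Zpair (q : QuadraticForm R A) : (n : ℕ) → A → (Fin n → R) → (Fin n → R) →
    Matrix (Fin (2 ^ n)) (Fin (2 ^ n)) A × Matrix (Fin (2 ^ n)) (Fin (2 ^ n)) A
  | 0, α, _, _ => (Matrix.of fun _ _ => α, Matrix.of fun _ _ => conj q α)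
  | n + 1, α, v, w =>
      (block (v (Fin.last n) • 1) (Zpair q n α (Fin.init v) (Fin.init w)).1
        (-(Zpair q n α (Fin.init v) (Fin.init w)).2) (w (Fin.last n) • 1),
       block (w (Fin.last n) • 1) (-(Zpair q n α (Fin.init v) (Fin.init w)).1)
        (Zpair q n α (Fin.init v) (Fin.init w)).2 (v (Fin.last n) • 1))

/-- The matrix `Z_n(α, v, w)`. -/
def Z (q : QuadraticForm R A) (n : ℕ) (α : A) (v w : Fin n → R) :
    Matrix (Fin (2 ^ n)) (Fin (2 ^ n)) A :=
  (Zpair q n α v w).1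

/-- The conjugate matrix of `Z_n(α, v, w)`. -/
def Zbar (q : QuadraticForm R A) (n : ℕ) (α : A) (v w : Fin n → R) :
    Matrix (Fin (2 ^ n)) (Fin (2 ^ n)) A :=
  (Zpair q n α v w).2

/-- The linear map `V → M_{2^(n+1)}(A)` sends `(α, v, w)` to the matrix with blocks
`0, Z_n(α, v, w)` and `conj Z_n(α, v, w), 0`. -/
def phiOnV (q : QuadraticForm R A) (n : ℕ) (x : A × ((Fin n → R) × (Fin n → R))) :
    Matrix (Fin (2 ^ (n + 1))) (Fin (2 ^ (n + 1))) A :=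
  block 0 (Z q n x.1 x.2.1 x.2.2) (Zbar q n x.1 x.2.1 x.2.2) 0

/-- `φ` is a (unital) `R`-algebra homomorphism `Cl(V) → M_{2^(n+1)}(A)` that extends the map
`phiOnV` on `V`. -/
structure IsCliffordLift (q : QuadraticForm R A) (n : ℕ)
    (φ : CliffordAlgebra (spaceForm q n) →ₗ[R]
      Matrix (Fin (2 ^ (n + 1))) (Fin (2 ^ (n + 1))) A) : Prop where
  map_one : φ 1 = 1
  map_mul : ∀ x y, φ (x * y) = φ x * φ y
  map_ι : ∀ x, φ (CliffordAlgebra.ι (spaceForm q n) x) = phiOnV q n x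

end Matrices

end QuatClifford

/-! The alternating form `⟨(xy)z - x(yz), w⟩` has top degree on a module of rank 4 and vanishes when
an argument is 1. It is therefore zero, and `A` is associative (`IsQuaternionAlgebra.mul_assoc`).
Then `M_{2^(n+1)}(A)` is an associative algebra, and `Z_n` times its conjugate is the scalar `q(α,
v, w)` in both orders (`Zpair_mul`), so the universal property of `Cl(V)` gives `φ`.

Non-degeneracy only makes `v ↦ ⟨v, ·⟩` injective, so no simplicity argument for `Cl(V)` is used for
injectivity. Instead, conjugation by `diag(1, -1)` realises the grading involution on matrices, so
`ker φ` is stable under `x ↦ v x - involute(x) v`, which is contraction with `⟨v, ·⟩`. Contractions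
lower degree, and an element killed by all of them is a scalar, so a nonzero kernel would contain a
nonzero scalar (`eq_zero_of_mem_of_contractLeft_mem`). This is impossible because `R` embeds in `A`.
-/

namespace QuatClifford

/-! ### Clifford algebras of free modules, and contractions -/

section CliffordFree

open CliffordAlgebra

variable {R M : Type*} [CommRing R] [AddCommGroup M] [Module R M] (Q : QuadraticForm R M)

/-- Such a `B`, not required to be symmetric, deforms `Q` to the zero form and so identifies the
Clifford algebra linearly with the exterior algebra, also when 2 is not invertible. -/
theorem exists_bilin_toQuadraticMap_eq_zero_sub [Module.Free R M] :
    ∃ B : LinearMap.BilinForm R M, B.toQuadraticMap = 0 - Q :=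
  LinearMap.BilinMap.toQuadraticMap_surjective (0 - Q)

/-- A basis of the Clifford algebra of a form on a finite free module. -/
noncomputable def cliffordAlgebraBasis [Module.Free R M] [Module.Finite R M] [Nontrivial R] :
    Module.Basis (Finset (Fin (Module.finrank R M))) R (CliffordAlgebra Q) :=
  (Module.finBasis R M).ExteriorAlgebra.map
    (changeFormEquiv (exists_bilin_toQuadraticMap_eq_zero_sub Q).choose_spec).symm

theorem cliffordAlgebra_free [Module.Free R M] [Module.Finite R M] [Nontrivial R] :
    Module.Free R (CliffordAlgebra Q) :=
  Module.Free.of_basis (cliffordAlgebraBasis Q)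

theorem cliffordAlgebra_finite [Module.Free R M] [Module.Finite R M] [Nontrivial R] :
    Module.Finite R (CliffordAlgebra Q) :=
  Module.Finite.of_basis (cliffordAlgebraBasis Q)

theorem finrank_cliffordAlgebra [Module.Free R M] [Module.Finite R M] [Nontrivial R] :
    Module.finrank R (CliffordAlgebra Q) = 2 ^ Module.finrank R M := by
  simp [Module.finrank_eq_card_basis (cliffordAlgebraBasis Q)]

/-- If `f e = 1`, contracting `e ∧ x` with `f` is the algebra map that projects `M` along `e`. -/
theorem contractLeft_ι_mul_eq_map (f : Module.Dual R M) (e : M) (he : f e = 1)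
    (x : ExteriorAlgebra R M) :
    contractLeft (Q := (0 : QuadraticForm R M)) f (ExteriorAlgebra.ι R e * x) =
      ExteriorAlgebra.map (LinearMap.id - f.smulRight e) x := by
  induction x using CliffordAlgebra.left_induction with
  | algebraMap r =>
    rw [contractLeft_ι_mul, contractLeft_algebraMap, he, AlgHom.commutes]
    simp
  | add x y hx hy => rw [mul_add, map_add, map_add, hx, hy]
  | ι_mul x v hx =>
    rw [map_mul (ExteriorAlgebra.map _), ← hx]
    change _ = ExteriorAlgebra.map (LinearMap.id - f.smulRight e) (ExteriorAlgebra.ι R v) * _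
    rw [ExteriorAlgebra.map_apply_ι]
    have h1 : ExteriorAlgebra.ι R e * ExteriorAlgebra.ι R v
        = -(ExteriorAlgebra.ι R v * ExteriorAlgebra.ι R e) :=
      eq_neg_of_add_eq_zero_left (ExteriorAlgebra.ι_add_mul_swap e v)
    change contractLeft f (ExteriorAlgebra.ι R e * (ExteriorAlgebra.ι R v * x)) = _
    rw [← mul_assoc, h1, neg_mul, mul_assoc, map_neg]
    erw [contractLeft_ι_mul, contractLeft_ι_mul]
    simp only [LinearMap.sub_apply, LinearMap.id_apply, LinearMap.smulRight_apply, map_sub,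
      map_smul, he, one_smul, sub_mul, mul_sub, neg_sub, smul_mul_assoc]
    -- The only surplus term of the expansion contains `e ∧ e`.
    have h2 : ExteriorAlgebra.ι R e * (ExteriorAlgebra.ι R e *
        (contractLeft (Q := (0 : QuadraticForm R M)) f x)) = 0 := by
      rw [← mul_assoc, ExteriorAlgebra.ι_sq_zero, zero_mul]
    have h3 := congrArg (f v • ·) h2
    simp only [smul_zero] at h3
    erw [h3]
    abel

/-- Each projection along a basis vector fixes `x`. Their composite is zero on `M`, and the algebra
map induced by zero factors through the scalars. -/
theorem exterior_mem_range_of_contractLeft_eq_zero [Module.Free R M] [Module.Finite R M]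
    (x : ExteriorAlgebra R M)
    (h : ∀ f : Module.Dual R M, contractLeft (Q := (0 : QuadraticForm R M)) f x = 0) :
    ∃ r : R, x = algebraMap R _ r := by
  let b := Module.Free.chooseBasis R M
  have h1 : ∀ i, ExteriorAlgebra.map (LinearMap.id - (b.coord i).smulRight (b i)) x = x := by
    intro i
    rw [← contractLeft_ι_mul_eq_map _ _ (by simp)]
    erw [contractLeft_ι_mul]
    simp [h]
  have h2 : ∀ s : Finset (Module.Free.ChooseBasisIndex R M),
      ∃ p : M →ₗ[R] M, (∀ i ∈ s, p (b i) = 0) ∧ ExteriorAlgebra.map p x = x := by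
    classical
    intro s
    induction s using Finset.induction_on with
    | empty => exact ⟨LinearMap.id, by simp, by simp⟩
    | insert i s _ ih =>
      obtain ⟨p, hp, hx⟩ := ih
      refine ⟨p ∘ₗ (LinearMap.id - (b.coord i).smulRight (b i)), ?_, ?_⟩
      · intro j hj
        by_cases hij : j = i
        · subst hij; simp
        · have : (b.coord i) (b j) = 0 := by simp [hij]
          simp only [LinearMap.comp_apply, LinearMap.sub_apply, LinearMap.smulRight_apply, this]
          simpa using hp j (Finset.mem_of_mem_insert_of_ne hj hij)
      · rw [← ExteriorAlgebra.map_comp_map, AlgHom.comp_apply, h1, hx]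
  obtain ⟨p, hp, hx⟩ := h2 Finset.univ
  obtain rfl : p = 0 := b.ext fun i => by simpa using hp i (Finset.mem_univ i)
  refine ⟨ExteriorAlgebra.algebraMapInv x, ?_⟩
  have : ExteriorAlgebra.map (0 : M →ₗ[R] M) =
      (Algebra.ofId R (ExteriorAlgebra R M)).comp ExteriorAlgebra.algebraMapInv := by
    ext m
    simp [ExteriorAlgebra.algebraMapInv]
  rw [this] at hx
  exact hx.symm

/-- `changeForm` commutes with contractions and fixes scalars, which reduces to the exterior
algebra. -/
theorem mem_range_algebraMap_of_contractLeft_eq_zero [Module.Free R M] [Module.Finite R M]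
    (x : CliffordAlgebra Q) (h : ∀ f : Module.Dual R M, contractLeft f x = 0) :
    ∃ r : R, x = algebraMap R _ r := by
  obtain ⟨B, hB⟩ := exists_bilin_toQuadraticMap_eq_zero_sub Q
  obtain ⟨r, hr⟩ := exterior_mem_range_of_contractLeft_eq_zero (changeForm hB x) fun f => by
    rw [← changeForm_contractLeft, h, map_zero]
  refine ⟨r, (changeFormEquiv hB).injective ?_⟩
  simpa using hr

/-- The elements of a Clifford algebra that are killed by any `k` successive contractions. -/
def contractionKernel : ℕ → Submodule R (CliffordAlgebra Q)
  | 0 => ⊥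
  | k + 1 => ⨅ f : Module.Dual R M, (contractionKernel k).comap (contractLeft f)

variable {Q}

theorem mem_contractionKernel_succ {k : ℕ} {x : CliffordAlgebra Q} :
    x ∈ contractionKernel Q (k + 1) ↔
      ∀ f : Module.Dual R M, contractLeft f x ∈ contractionKernel Q k := by
  simp [contractionKernel]

theorem contractionKernel_le_succ (k : ℕ) :
    contractionKernel Q k ≤ contractionKernel Q (k + 1) := by
  induction k with
  | zero => exact bot_le
  | succ k ih =>
    intro x hx
    rw [mem_contractionKernel_succ] at hx ⊢
    exact fun f => ih (hx f)

theorem contractionKernel_mono : Monotone (contractionKernel Q) :=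
  monotone_nat_of_le_succ contractionKernel_le_succ

theorem ι_mul_mem_contractionKernel (v : M) {k : ℕ} {x : CliffordAlgebra Q}
    (hx : x ∈ contractionKernel Q k) : ι Q v * x ∈ contractionKernel Q (k + 1) := by
  induction k generalizing x with
  | zero =>
    obtain rfl : x = 0 := hx
    simp
  | succ k ih =>
    rw [mem_contractionKernel_succ]
    intro f
    rw [contractLeft_ι_mul]
    exact sub_mem (Submodule.smul_mem _ _ hx) (ih (mem_contractionKernel_succ.1 hx f))

theorem exists_mem_contractionKernel (x : CliffordAlgebra Q) :
    ∃ k, x ∈ contractionKernel Q k := by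
  induction x using CliffordAlgebra.left_induction with
  | algebraMap r => exact ⟨1, mem_contractionKernel_succ.2 fun f => by simp⟩
  | add x y hx hy =>
    obtain ⟨k, hk⟩ := hx
    obtain ⟨l, hl⟩ := hy
    exact ⟨max k l, add_mem (contractionKernel_mono (le_max_left k l) hk)
      (contractionKernel_mono (le_max_right k l) hl)⟩
  | ι_mul x v hx =>
    obtain ⟨k, hk⟩ := hx
    exact ⟨k + 1, ι_mul_mem_contractionKernel v hk⟩

/-- The forms `⟨v, ·⟩` need not span the dual. But for a functional `l` on the Clifford algebra, `f
↦ l(f ⌟ x)` is evaluation at some `m` by reflexivity, and `m` is orthogonal to everything, hence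
zero. Functionals separate points of a free module. -/
theorem contractLeft_eq_zero_of_polar [Module.Free R M] [Module.Finite R M] [Nontrivial R]
    (hQ : ∀ x : M, (∀ y : M, QuadraticMap.polar Q x y = 0) → x = 0) (x : CliffordAlgebra Q)
    (h : ∀ v : M, contractLeft (QuadraticMap.polarBilin Q v) x = 0) (f : Module.Dual R M) :
    contractLeft f x = 0 := by
  have := cliffordAlgebra_free Q
  rw [← Module.forall_dual_apply_eq_zero_iff R]
  intro l
  obtain ⟨m, hm⟩ := (Module.evalEquiv R M).surjective (l ∘ₗ (contractLeft (Q := Q)).flip x)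
  have hm' : ∀ g : Module.Dual R M, g m = l (contractLeft g x) := fun g => by
    simpa using LinearMap.congr_fun hm g
  obtain rfl : m = 0 := hQ m fun y => by
    have := hm' (QuadraticMap.polarBilin Q y)
    rw [h, map_zero] at this
    rw [QuadraticMap.polar_comm]
    simpa using this
  rw [← hm', map_zero]

/-- For a weakly nondegenerate form, a subspace that is stable under contraction with vectors and
meets the scalars trivially is zero. -/
theorem eq_zero_of_mem_of_contractLeft_mem [Module.Free R M] [Module.Finite R M] [Nontrivial R]
    (hQ : ∀ x : M, (∀ y : M, QuadraticMap.polar Q x y = 0) → x = 0)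
    (K : Submodule R (CliffordAlgebra Q))
    (hK : ∀ x ∈ K, ∀ v : M, contractLeft (QuadraticMap.polarBilin Q v) x ∈ K)
    (hK0 : ∀ r : R, algebraMap R (CliffordAlgebra Q) r ∈ K → r = 0)
    (x : CliffordAlgebra Q) (hx : x ∈ K) : x = 0 := by
  obtain ⟨k, hk⟩ := exists_mem_contractionKernel x
  induction k generalizing x with
  | zero => exact hk
  | succ k ih =>
    obtain ⟨r, rfl⟩ := mem_range_algebraMap_of_contractLeft_eq_zero Q x
      (contractLeft_eq_zero_of_polar hQ x fun v =>
        ih _ (hK x hx v) (mem_contractionKernel_succ.1 hk _))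
    rw [hK0 r hx, map_zero]

/-- This expresses the contraction through products and `involute`, so that an algebra homomorphism
can be applied to it. -/
theorem contractLeft_polar_eq (v : M) (x : CliffordAlgebra Q) :
    contractLeft (QuadraticMap.polarBilin Q v) x = ι Q v * x - involute x * ι Q v := by
  induction x using CliffordAlgebra.left_induction with
  | algebraMap r => simp [Algebra.commutes]
  | add x y hx hy =>
    rw [map_add, hx, hy, map_add]
    noncomm_ring
  | ι_mul x w hx =>
    have h := ι_mul_ι_add_swap (Q := Q) v w
    rw [contractLeft_ι_mul, hx, map_mul, involute_ι, QuadraticMap.polarBilin_apply_apply,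
      Algebra.smul_def, ← h]
    noncomm_ring

end CliffordFree

end QuatClifford

namespace QuatClifford

/-! ### Identities in composition algebras; the associator form -/

namespace IsCompositionAlgebra

open QuadraticMap

variable {R A : Type*} [CommRing R] [NonAssocRing A] [Module R A] [IsScalarTower R A A]
  [SMulCommClass R A A] {q : QuadraticForm R A} (hq : IsCompositionAlgebra q)

include hq

theorem eq_of_polar_eq {x y : A} (h : ∀ z, polar q x z = polar q y z) : x = y :=
  sub_eq_zero.1 (hq.nondegenerate _ fun z => by rw [polar_sub_left, h, sub_self])

theorem polar_mul_left (x y z : A) : polar q (x * y) (x * z) = q x * polar q y z := by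
  simp only [polar, ← mul_add, hq.map_mul]
  ring

theorem polar_mul_right (x y z : A) : polar q (x * z) (y * z) = polar q x y * q z := by
  simp only [polar, ← add_mul, hq.map_mul]
  ring

/-- Linearisation of `polar_mul_right` in its right factor. -/
theorem polar_mul_add_polar_mul (x y z w : A) :
    polar q (x * y) (z * w) + polar q (x * w) (z * y) = polar q x z * polar q y w := by
  have h := hq.polar_mul_right x z (y + w)
  simp only [mul_add, polar_add_left, polar_add_right, hq.polar_mul_right] at h
  have h2 : q (y + w) = q y + q w + polar q y w := by simp [polar]
  rw [h2] at h
  linear_combination h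

theorem map_one : q 1 = 1 := by
  have h : q 1 • (1 : A) = (1 : R) • (1 : A) := hq.eq_of_polar_eq fun z => by
    have := hq.polar_mul_left 1 1 z
    simpa [polar_smul_left] using this.symm
  exact hq.injective_smul_one h

theorem polar_conj_mul (x y z : A) : polar q (conj q x * y) z = polar q y (x * z) := by
  have h := hq.polar_mul_add_polar_mul x y 1 z
  simp only [one_mul] at h
  rw [conj, sub_mul, polar_sub_left, smul_mul_assoc, one_mul, polar_smul_left, smul_eq_mul,
    polar_comm q y (x * z)]
  linear_combination -h

theorem polar_mul_conj (x y z : A) : polar q (y * conj q x) z = polar q y (z * x) := by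
  have h := hq.polar_mul_add_polar_mul y x z 1
  simp only [mul_one] at h
  rw [conj, mul_sub, polar_sub_left, mul_smul_comm, mul_one, polar_smul_left, smul_eq_mul]
  linear_combination -h

theorem conj_mul_mul (x y : A) : conj q x * (x * y) = q x • y :=
  hq.eq_of_polar_eq fun z => by
    rw [hq.polar_conj_mul, hq.polar_mul_left, polar_smul_left, smul_eq_mul]

theorem mul_mul_conj (x y : A) : y * x * conj q x = q x • y :=
  hq.eq_of_polar_eq fun z => by
    rw [hq.polar_mul_conj, hq.polar_mul_right, polar_smul_left, smul_eq_mul, mul_comm]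

theorem conj_mul_self (x : A) : conj q x * x = q x • 1 := by
  simpa using hq.conj_mul_mul x 1

theorem mul_conj_self (x : A) : x * conj q x = q x • 1 := by
  simpa using hq.mul_mul_conj x 1

/-- Both `conj x * (x * y)` and `(conj x * x) * y` equal `q x • y`; substitute `conj x = ⟨x, 1⟩ 1 -
x`. -/
theorem mul_self_mul (x y : A) : x * x * y = x * (x * y) := by
  have h1 := hq.conj_mul_mul x y
  have h2 := congrArg (· * y) (hq.conj_mul_self x)
  simp only [conj, sub_mul, smul_mul_assoc, one_mul] at h1 h2
  exact sub_right_injective (h2.trans h1.symm)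

theorem mul_mul_self (x y : A) : x * y * y = x * (y * y) := by
  have h1 := hq.mul_mul_conj y x
  have h2 := congrArg (x * ·) (hq.mul_conj_self y)
  simp only [conj, mul_sub, mul_smul_comm, mul_one] at h1 h2
  exact sub_right_injective (h1.trans h2.symm)

/-- Both terms equal `⟨xy, 1⟩ q(z)`; for the second, move `x` across the form as `conj x` and cancel
`z`. -/
theorem polar_associator_self (x y z : A) : polar q (x * y * z - x * (y * z)) z = 0 := by
  have h1 : polar q (x * y * z) z = polar q (x * y) 1 * q z := by
    simpa using hq.polar_mul_right (x * y) 1 z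
  have h2 : polar q (x * (y * z)) z = polar q (x * y) 1 * q z := by
    have h3 := hq.polar_conj_mul x 1 y
    rw [mul_one] at h3
    rw [polar_comm, ← hq.polar_conj_mul, hq.polar_mul_right, h3, polar_comm]
  rw [polar_sub_left, h1, h2, sub_self]

omit hq

/-- The form `⟨(x, y, z), w⟩`, where `(x, y, z)` is the associator. -/
def associatorForm (q : QuadraticForm R A) (v : Fin 4 → A) : R :=
  polar q (v 0 * v 1 * v 2 - v 0 * (v 1 * v 2)) (v 3)

/-- `associatorForm` as a multilinear map. -/
def associatorMultilinear (q : QuadraticForm R A) :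
    MultilinearMap R (fun _ : Fin 4 => A) R where
  toFun := associatorForm q
  map_update_add' := by
    intro inst m i x y
    -- Fixing the decidability instance lets `Function.update` evaluate at numerals.
    obtain rfl : inst = instDecidableEqFin 4 := Subsingleton.elim _ _
    fin_cases i <;>
    · simp only [associatorForm, Function.update, Fin.isValue, Fin.reduceFinMk, Fin.reduceEq,
        dite_true, dite_false, mul_add, add_mul, polar_sub_left, polar_add_left, polar_add_right]
      try ring
  map_update_smul' := by
    intro inst m i c x
    obtain rfl : inst = instDecidableEqFin 4 := Subsingleton.elim _ _
    fin_cases i <;>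
    · simp only [associatorForm, Function.update, Fin.isValue, Fin.reduceFinMk, Fin.reduceEq,
        dite_true, dite_false, mul_smul_comm, smul_mul_assoc, polar_sub_left, polar_smul_left,
        polar_smul_right, smul_eq_mul]
      try ring

include hq

theorem associator_self_left (x y : A) : x * x * y - x * (x * y) = 0 :=
  sub_eq_zero.2 (hq.mul_self_mul x y)

theorem associator_self_right (x y : A) : x * y * y - x * (y * y) = 0 :=
  sub_eq_zero.2 (hq.mul_mul_self x y)

theorem associator_swap_left (x y z : A) :
    x * y * z - x * (y * z) = -(y * x * z - y * (x * z)) := by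
  have h := hq.associator_self_left (x + y) z
  have hx := hq.associator_self_left x z
  have hy := hq.associator_self_left y z
  rw [eq_neg_iff_add_eq_zero, ← h, ← sub_eq_zero, ← neg_eq_zero, ← add_zero (0 : A)]
  nth_rewrite 1 [← hx]
  nth_rewrite 1 [← hy]
  simp only [add_mul, mul_add]
  abel

theorem associator_flexible (x y : A) : x * y * x - x * (y * x) = 0 := by
  rw [hq.associator_swap_left, hq.associator_self_right, neg_zero]

theorem polar_associator_swap (x y z w : A) :
    polar q (x * y * z - x * (y * z)) w = -polar q (x * y * w - x * (y * w)) z := by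
  have h := hq.polar_associator_self x y (z + w)
  have hz := hq.polar_associator_self x y z
  have hw := hq.polar_associator_self x y w
  simp only [mul_add, polar_sub_left, polar_add_left, polar_add_right] at h hz hw ⊢
  linear_combination h - hz - hw

theorem associatorForm_eq_zero_of_eq (v : Fin 4 → A) (i j : Fin 4) (h : v i = v j) (hij : i ≠ j) :
    associatorForm q v = 0 := by
  have h2 (x y z : A) : polar q (x * y * z - x * (y * z)) y = 0 := by
    rw [hq.polar_associator_swap, hq.associator_self_right]
    simp
  have h1 (x y z : A) : polar q (x * y * z - x * (y * z)) x = 0 := by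
    rw [hq.polar_associator_swap, hq.associator_flexible]
    simp
  unfold associatorForm
  fin_cases i <;> fin_cases j <;> first | exact absurd rfl hij | skip
  all_goals
    simp only [Fin.isValue, Fin.reduceFinMk, Fin.zero_eta, Fin.mk_one] at h
    simp [h, h1, h2, hq.polar_associator_self, hq.associator_self_left, hq.associator_self_right,
      hq.associator_flexible]

/-- An associator with an entry 1 vanishes; a 1 in the last slot is first swapped into the
associator. -/
theorem associatorForm_eq_zero_of_eq_one (v : Fin 4 → A) (i : Fin 4) (h : v i = 1) : associatorForm q v = 0 := by
  have h3 (x y z : A) : polar q (x * y * z - x * (y * z)) 1 = 0 := by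
    rw [hq.polar_associator_swap]
    simp
  unfold associatorForm
  fin_cases i <;>
  · simp only [Fin.isValue, Fin.reduceFinMk, Fin.zero_eta, Fin.mk_one] at h
    simp [h, h3]

end IsCompositionAlgebra

/-! ### Associativity in rank 4 -/

namespace IsQuaternionAlgebra

open QuadraticMap IsCompositionAlgebra

variable {R A : Type*} [CommRing R] [NonAssocRing A] [Module R A] [IsScalarTower R A A]
  [SMulCommClass R A A] {q : QuadraticForm R A}

theorem nontrivial (hq : IsQuaternionAlgebra q) : Nontrivial R := by
  by_contra h
  rw [not_nontrivial_iff_subsingleton] at h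
  have h4 := hq.rank_eq_four
  simp [Module.finrank] at h4

/-- Quaternion algebras are associative: an alternating form in four variables on a module of
rank `4` vanishes if it vanishes whenever one of the variables is `1`. -/
theorem mul_assoc (hq : IsQuaternionAlgebra q) (x y z : A) : x * y * z = x * (y * z) := by
  have := hq.nontrivial
  have := hq.free
  have := hq.finite
  have hc := hq.toIsCompositionAlgebra
  let b : Module.Basis (Fin 4) R A := Module.finBasisOfFinrankEq R A hq.rank_eq_four
  let f : A [⋀^Fin 4]→ₗ[R] R :=
    { associatorMultilinear q with
      map_eq_zero_of_eq' := fun v i j h hij => hc.associatorForm_eq_zero_of_eq v i j h hij }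
  -- Expand 1 in the basis in slot `i`: by alternation only the `b i` term survives.
  have hf1 (i : Fin 4) : b.repr 1 i * f b = 0 := by
    have h : f (Function.update b i 1) = 0 :=
      hc.associatorForm_eq_zero_of_eq_one _ i (by simp)
    rw [← h]
    nth_rewrite 2 [← b.sum_repr 1]
    rw [AlternatingMap.map_update_sum, Finset.sum_eq_single i]
    · rw [AlternatingMap.map_update_smul, Function.update_eq_self, smul_eq_mul]
    · intro j _ hj
      rw [AlternatingMap.map_update_smul, f.map_update_self _ hj.symm, smul_zero]
    · simp
  -- All coordinates of 1 annihilate `f b`, so `f b • 1 = 0`, and `R` embeds in `A`.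
  have hfb : f b = 0 := by
    apply hc.injective_smul_one
    simp only [zero_smul]
    apply b.ext_elem
    intro i
    simp [mul_comm _ (b.repr 1 i), hf1]
  have hf : f = 0 := by rw [f.eq_smul_basis_det b, hfb, zero_smul]
  refine sub_eq_zero.1 (hc.nondegenerate _ fun w => ?_)
  exact congrArg (fun g : A [⋀^Fin 4]→ₗ[R] R => g ![x, y, z, w]) hf

end IsQuaternionAlgebra

end QuatClifford

namespace QuatClifford

/-! ### Block matrix arithmetic -/

section Blocks

variable {R A : Type*} {n : ℕ}

theorem block_add [Add A] (X Y Z W X' Y' Z' W' : Matrix (Fin (2 ^ n)) (Fin (2 ^ n)) A) :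
    block X Y Z W + block X' Y' Z' W' = block (X + X') (Y + Y') (Z + Z') (W + W') := by
  simp only [block, ← Matrix.fromBlocks_add]
  rfl

theorem block_smul [SMul R A] (r : R) (X Y Z W : Matrix (Fin (2 ^ n)) (Fin (2 ^ n)) A) :
    r • block X Y Z W = block (r • X) (r • Y) (r • Z) (r • W) := by
  simp only [block, ← Matrix.fromBlocks_smul]
  rfl

theorem block_neg [Neg A] (X Y Z W : Matrix (Fin (2 ^ n)) (Fin (2 ^ n)) A) :
    -block X Y Z W = block (-X) (-Y) (-Z) (-W) := by
  simp only [block, ← Matrix.fromBlocks_neg]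
  rfl

theorem block_one [Zero A] [One A] :
    block (1 : Matrix (Fin (2 ^ n)) (Fin (2 ^ n)) A) 0 0 1 = 1 := by
  simp [block]

theorem block_mul [NonUnitalNonAssocSemiring A]
    (X Y Z W X' Y' Z' W' : Matrix (Fin (2 ^ n)) (Fin (2 ^ n)) A) :
    block X Y Z W * block X' Y' Z' W' =
      block (X * X' + Y * Z') (X * Y' + Y * W') (Z * X' + W * Z') (Z * Y' + W * W') := by
  simp only [block, ← Matrix.fromBlocks_multiply, Matrix.reindex_apply,
    Matrix.submatrix_mul_equiv]

end Blocks

/-! ### Linearity of the matrices in `(α, v, w)` -/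

section Linear

variable {R A : Type*} [CommRing R] [NonAssocRing A] [Module R A] (q : QuadraticForm R A)

theorem conj_add (x y : A) : conj q (x + y) = conj q x + conj q y := by
  simp only [conj, QuadraticMap.polar_add_left, add_smul]
  abel

theorem conj_smul (r : R) (x : A) : conj q (r • x) = r • conj q x := by
  simp only [conj, QuadraticMap.polar_smul_left, smul_sub, smul_smul, smul_eq_mul]

theorem Zpair_add (n : ℕ) (α β : A) (v w v' w' : Fin n → R) :
    Zpair q n (α + β) (v + v') (w + w') = Zpair q n α v w + Zpair q n β v' w' := by
  induction n with
  | zero =>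
    refine Prod.ext rfl ?_
    ext i j
    exact conj_add q α β
  | succ n ih =>
    have hv : Fin.init (v + v') = Fin.init v + Fin.init v' := rfl
    have hw : Fin.init (w + w') = Fin.init w + Fin.init w' := rfl
    simp only [Zpair, hv, hw, ih, Prod.mk_add_mk, block_add, Pi.add_apply, add_smul, Prod.fst_add,
      Prod.snd_add, neg_add]

theorem Zpair_smul (n : ℕ) (r : R) (α : A) (v w : Fin n → R) :
    Zpair q n (r • α) (r • v) (r • w) = r • Zpair q n α v w := by
  induction n with
  | zero =>
    refine Prod.ext rfl ?_
    ext i j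
    exact conj_smul q r α
  | succ n ih =>
    have hv : Fin.init (r • v) = r • Fin.init v := rfl
    have hw : Fin.init (r • w) = r • Fin.init w := rfl
    simp only [Zpair, hv, hw, ih, Prod.smul_mk, block_smul, Pi.smul_apply, smul_smul,
      Prod.smul_fst, Prod.smul_snd, smul_neg, smul_eq_mul]

/-- `phiOnV` as a linear map. -/
def phiLinear (n : ℕ) : A × ((Fin n → R) × (Fin n → R)) →ₗ[R]
    Matrix (Fin (2 ^ (n + 1))) (Fin (2 ^ (n + 1))) A where
  toFun := phiOnV q n
  map_add' x y := by
    simp only [phiOnV, Z, Zbar, Prod.fst_add, Prod.snd_add, Zpair_add, block_add, add_zero]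
  map_smul' r x := by
    simp only [phiOnV, Z, Zbar, Prod.smul_fst, Prod.smul_snd, Zpair_smul, block_smul, smul_zero,
      RingHom.id_apply]

end Linear

/-! ### Non-degeneracy of the quadratic space -/

section Nondegenerate

variable {R A : Type*} [CommRing R] [NonAssocRing A] [Module R A] {q : QuadraticForm R A}

theorem polar_spaceForm (n : ℕ) (α β : A) (v w v' w' : Fin n → R) :
    QuadraticMap.polar (spaceForm q n) (α, v, w) (β, v', w') =
      QuadraticMap.polar q α β + (v ⬝ᵥ w' + v' ⬝ᵥ w) := by
  simp only [QuadraticMap.polar, Prod.mk_add_mk, spaceForm_apply, add_dotProduct, dotProduct_add]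
  ring

theorem spaceForm_nondegenerate
    (hq : ∀ x : A, (∀ y : A, QuadraticMap.polar q x y = 0) → x = 0) (n : ℕ)
    (x : A × ((Fin n → R) × (Fin n → R)))
    (h : ∀ y, QuadraticMap.polar (spaceForm q n) x y = 0) : x = 0 := by
  obtain ⟨α, v, w⟩ := x
  have hα : α = 0 := hq α fun β => by simpa [polar_spaceForm] using h (β, 0, 0)
  have hv : v = 0 := funext fun i => by
    simpa [polar_spaceForm] using h (0, 0, Pi.single i 1)
  have hw : w = 0 := funext fun i => by
    simpa [polar_spaceForm] using h (0, Pi.single i 1, 0)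
  rw [hα, hv, hw]
  rfl

end Nondegenerate

/-! ### The homomorphism, its grading and its injectivity -/

section Lift

variable {R A : Type*} [CommRing R] [Ring A] [Algebra R A] {q : QuadraticForm R A}

/-- The scalar blocks are central, so off-diagonal blocks cancel and each diagonal block gains `a_n
b_n`. Each order of the product involves both orders one level down, hence the joint induction. -/
theorem Zpair_mul (h1 : ∀ x : A, x * conj q x = q x • 1) (h2 : ∀ x : A, conj q x * x = q x • 1)
    (n : ℕ) (α : A) (v w : Fin n → R) :
    (Zpair q n α v w).1 * (Zpair q n α v w).2 = spaceForm q n (α, v, w) • 1 ∧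
      (Zpair q n α v w).2 * (Zpair q n α v w).1 = spaceForm q n (α, v, w) • 1 := by
  simp only [spaceForm_apply]
  induction n with
  | zero =>
    constructor <;> ext i j <;> obtain rfl := Subsingleton.elim (α := Fin 1) i j <;>
      simp [Zpair, Matrix.mul_apply, h1, h2]
  | succ n ih =>
    obtain ⟨ih1, ih2⟩ := ih (Fin.init v) (Fin.init w)
    have hd : v ⬝ᵥ w = Fin.init v ⬝ᵥ Fin.init w + v (Fin.last n) * w (Fin.last n) := by
      simp only [dotProduct, Fin.sum_univ_castSucc]
      rfl
    rw [← block_one]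
    constructor
    all_goals
      simp only [Zpair, block_mul, block_smul, smul_zero, smul_mul_assoc, mul_smul_comm, one_mul,
        mul_one, neg_mul, mul_neg, neg_neg, ih1, ih2, hd]
      congr 1 <;> simp [add_smul, smul_smul, mul_comm, add_comm, add_left_comm]

theorem phiLinear_mul_self (h1 : ∀ x : A, x * conj q x = q x • 1)
    (h2 : ∀ x : A, conj q x * x = q x • 1) (n : ℕ) (x : A × ((Fin n → R) × (Fin n → R))) :
    phiLinear q n x * phiLinear q n x = algebraMap R _ (spaceForm q n x) := by
  obtain ⟨h3, h4⟩ := Zpair_mul h1 h2 n x.1 x.2.1 x.2.2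
  change block _ _ _ _ * block _ _ _ _ = _
  simp only [block_mul, Z, Zbar, h3, h4, Algebra.algebraMap_eq_smul_one, ← block_one, block_smul]
  simp

/-- The algebra homomorphism from the Clifford algebra that extends `phiOnV`. -/
noncomputable def phi (h1 : ∀ x : A, x * conj q x = q x • 1)
    (h2 : ∀ x : A, conj q x * x = q x • 1) (n : ℕ) :
    CliffordAlgebra (spaceForm q n) →ₐ[R] Matrix (Fin (2 ^ (n + 1))) (Fin (2 ^ (n + 1))) A :=
  CliffordAlgebra.lift (spaceForm q n) ⟨phiLinear q n, phiLinear_mul_self h1 h2 n⟩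

variable (h1 : ∀ x : A, x * conj q x = q x • 1) (h2 : ∀ x : A, conj q x * x = q x • 1) (n : ℕ)

theorem phi_ι (x : A × ((Fin n → R) × (Fin n → R))) :
    phi h1 h2 n (CliffordAlgebra.ι (spaceForm q n) x) = phiOnV q n x :=
  CliffordAlgebra.lift_ι_apply _ _ _

theorem isCliffordLift_phi : IsCliffordLift q n (phi h1 h2 n).toLinearMap where
  map_one := map_one (phi h1 h2 n)
  map_mul := map_mul (phi h1 h2 n)
  map_ι := phi_ι h1 h2 n

theorem IsCliffordLift.eq_of_isCliffordLift
    {φ ψ : CliffordAlgebra (spaceForm q n) →ₗ[R]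
      Matrix (Fin (2 ^ (n + 1))) (Fin (2 ^ (n + 1))) A}
    (hφ : IsCliffordLift q n φ) (hψ : IsCliffordLift q n ψ) : φ = ψ := by
  ext1 x
  induction x using CliffordAlgebra.left_induction with
  | algebraMap r => rw [Algebra.algebraMap_eq_smul_one, map_smul, map_smul, hφ.map_one, hψ.map_one]
  | add x y hx hy => rw [map_add, map_add, hx, hy]
  | ι_mul x v hx => rw [hφ.map_mul, hψ.map_mul, hφ.map_ι, hψ.map_ι, hx]

theorem isEvenMatrix_phi (x : CliffordAlgebra (spaceForm q n))
    (hx : x ∈ CliffordAlgebra.evenOdd (spaceForm q n) 0) : IsEvenMatrix (phi h1 h2 n x) := by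
  induction x, hx using CliffordAlgebra.even_induction with
  | algebraMap r =>
    refine ⟨r • 1, r • 1, ?_⟩
    rw [AlgHom.commutes, Algebra.algebraMap_eq_smul_one, ← block_one, block_smul, smul_zero]
  | add x y _ _ ihx ihy =>
    obtain ⟨X, Y, h⟩ := ihx
    obtain ⟨X', Y', h'⟩ := ihy
    refine ⟨X + X', Y + Y', ?_⟩
    rw [map_add, h, h', block_add, add_zero]
  | ι_mul_ι_mul v w x _ ih =>
    obtain ⟨X, Y, h⟩ := ih
    rw [map_mul, map_mul, h, phi_ι, phi_ι, phiOnV, phiOnV, block_mul, block_mul]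
    simp only [zero_mul, mul_zero, zero_add, add_zero]
    exact ⟨_, _, rfl⟩

theorem isOddMatrix_phi (x : CliffordAlgebra (spaceForm q n))
    (hx : x ∈ CliffordAlgebra.evenOdd (spaceForm q n) 1) : IsOddMatrix (phi h1 h2 n x) := by
  induction x, hx using CliffordAlgebra.odd_induction with
  | ι v => exact ⟨_, _, phi_ι h1 h2 n v⟩
  | add x y _ _ ihx ihy =>
    obtain ⟨X, Y, h⟩ := ihx
    obtain ⟨X', Y', h'⟩ := ihy
    refine ⟨X + X', Y + Y', ?_⟩
    rw [map_add, h, h', block_add, add_zero]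
  | ι_mul_ι_mul v w x _ ih =>
    obtain ⟨X, Y, h⟩ := ih
    rw [map_mul, map_mul, h, phi_ι, phi_ι, phiOnV, phiOnV, block_mul, block_mul]
    simp only [zero_mul, mul_zero, zero_add, add_zero]
    exact ⟨_, _, rfl⟩

/-- The matrix `diag(1, -1)` squares to 1 and anticommutes with the anti-diagonal images of vectors.
-/
theorem phi_involute (x : CliffordAlgebra (spaceForm q n)) :
    phi h1 h2 n (CliffordAlgebra.involute x) =
      block 1 0 0 (-1) * phi h1 h2 n x * block 1 0 0 (-1) := by
  have hJ : block (1 : Matrix (Fin (2 ^ n)) (Fin (2 ^ n)) A) 0 0 (-1) * block 1 0 0 (-1) = 1 := by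
    rw [block_mul, ← block_one]
    simp
  induction x using CliffordAlgebra.left_induction with
  | algebraMap r =>
    rw [AlgHom.commutes, AlgHom.commutes, Algebra.algebraMap_eq_smul_one, mul_smul_comm, mul_one,
      smul_mul_assoc, hJ]
  | add x y hx hy => rw [map_add, map_add, hx, hy, map_add, mul_add, add_mul]
  | ι_mul x v hx =>
    have hv : -phi h1 h2 n (CliffordAlgebra.ι (spaceForm q n) v) * block 1 0 0 (-1) =
        block 1 0 0 (-1) * phi h1 h2 n (CliffordAlgebra.ι (spaceForm q n) v) := by
      rw [phi_ι, phiOnV, block_neg, block_mul, block_mul]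
      simp
    rw [map_mul, map_mul, hx, CliffordAlgebra.involute_ι, map_neg, map_mul, ← mul_assoc,
      ← mul_assoc, hv, mul_assoc (block 1 0 0 (-1))]

theorem phi_injective (hq : IsCompositionAlgebra q) [Nontrivial R] :
    Function.Injective (phi h1 h2 n) := by
  have := hq.free
  have := hq.finite
  rw [injective_iff_map_eq_zero]
  intro x hx
  refine eq_zero_of_mem_of_contractLeft_mem (spaceForm_nondegenerate hq.nondegenerate n)
    (LinearMap.ker (phi h1 h2 n).toLinearMap) ?_ ?_ x hx
  · intro x hx v
    have hx' : phi h1 h2 n x = 0 := hx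
    change phi h1 h2 n _ = 0
    rw [contractLeft_polar_eq, map_sub, map_mul, map_mul, phi_involute, hx']
    simp
  · intro r hr
    replace hr : phi h1 h2 n (algebraMap R (CliffordAlgebra (spaceForm q n)) r) = 0 := hr
    rw [AlgHom.commutes, Algebra.algebraMap_eq_smul_one] at hr
    apply hq.injective_smul_one
    -- The `(0, 0)` entry of the scalar matrix is `r • 1` in `A`.
    simpa using congrFun (congrFun hr 0) 0

theorem exists_unique_clifford_embedding (hq : IsQuaternionAlgebra q) :
    (∃ φ : CliffordAlgebra (spaceForm q n) →ₗ[R]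
        Matrix (Fin (2 ^ (n + 1))) (Fin (2 ^ (n + 1))) A,
      IsCliffordLift q n φ ∧
      (∀ ψ, IsCliffordLift q n ψ → ψ = φ) ∧
      Function.Injective φ ∧
      (∀ x ∈ CliffordAlgebra.evenOdd (spaceForm q n) 0, IsEvenMatrix (φ x)) ∧
      (∀ x ∈ CliffordAlgebra.evenOdd (spaceForm q n) 1, IsOddMatrix (φ x))) := by
  have := hq.nontrivial
  have h1 := hq.toIsCompositionAlgebra.mul_conj_self
  have h2 := hq.toIsCompositionAlgebra.conj_mul_self
  exact ⟨(phi h1 h2 n).toLinearMap, isCliffordLift_phi h1 h2 n,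
    fun ψ hψ => hψ.eq_of_isCliffordLift n (isCliffordLift_phi h1 h2 n),
    phi_injective h1 h2 n hq.toIsCompositionAlgebra, isEvenMatrix_phi h1 h2 n,
    isOddMatrix_phi h1 h2 n⟩

end Lift

/-- The count is `2^(4 + 2n) = (2^(n+1))^2 * 4`. -/
theorem finrank_clifford_eq_finrank_matrix {R A : Type*} [CommRing R] [NonAssocRing A] [Module R A]
    [IsScalarTower R A A] [SMulCommClass R A A] {q : QuadraticForm R A}
    (hq : IsQuaternionAlgebra q) (n : ℕ) :
    Module.finrank R (CliffordAlgebra (spaceForm q n)) =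
      Module.finrank R (Matrix (Fin (2 ^ (n + 1))) (Fin (2 ^ (n + 1))) A) := by
  have := hq.nontrivial
  have := hq.free
  have := hq.finite
  rw [finrank_cliffordAlgebra, Module.finrank_matrix]
  simp only [Module.finrank_prod, Module.finrank_pi, Fintype.card_fin, hq.rank_eq_four]
  ring

end QuatClifford

theorem theorem8p1 {R A : Type*} [CommRing R] [NonAssocRing A] [Module R A]
    [IsScalarTower R A A] [SMulCommClass R A A] (q : QuadraticForm R A)
    (hq : QuatClifford.IsQuaternionAlgebra q) (n : ℕ) :
    (∃ φ : CliffordAlgebra (QuatClifford.spaceForm q n) →ₗ[R]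
        Matrix (Fin (2 ^ (n + 1))) (Fin (2 ^ (n + 1))) A,
      QuatClifford.IsCliffordLift q n φ ∧
      (∀ ψ, QuatClifford.IsCliffordLift q n ψ → ψ = φ) ∧
      Function.Injective φ ∧
      (∀ x ∈ CliffordAlgebra.evenOdd (QuatClifford.spaceForm q n) 0,
        QuatClifford.IsEvenMatrix (φ x)) ∧
      (∀ x ∈ CliffordAlgebra.evenOdd (QuatClifford.spaceForm q n) 1,
        QuatClifford.IsOddMatrix (φ x))) ∧
    Module.Free R (CliffordAlgebra (QuatClifford.spaceForm q n)) ∧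
    Module.Finite R (CliffordAlgebra (QuatClifford.spaceForm q n)) ∧
    Module.Free R (Matrix (Fin (2 ^ (n + 1))) (Fin (2 ^ (n + 1))) A) ∧
    Module.Finite R (Matrix (Fin (2 ^ (n + 1))) (Fin (2 ^ (n + 1))) A) ∧
    Module.finrank R (CliffordAlgebra (QuatClifford.spaceForm q n)) =
      Module.finrank R (Matrix (Fin (2 ^ (n + 1))) (Fin (2 ^ (n + 1))) A) := by
  have := hq.nontrivial
  have := hq.free
  have := hq.finite
  refine ⟨?_, QuatClifford.cliffordAlgebra_free _, QuatClifford.cliffordAlgebra_finite _,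
    inferInstance, inferInstance, QuatClifford.finrank_clifford_eq_finrank_matrix hq n⟩
  -- Both structures extend the given operations, so the associative result applies to the original
  -- data definitionally.
  let ringA : Ring A := { ‹NonAssocRing A› with mul_assoc := hq.mul_assoc }
  let algebraA : Algebra R A := Algebra.ofModule smul_mul_assoc fun r x y => mul_smul_comm r x y
  exact @QuatClifford.exists_unique_clifford_embedding R A _ ringA algebraA q n hq
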